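/- Let $\mathcal H$ be a real Hilbert space, $N\ge 1$, and let $C_1,\dots,C_N\subseteq\mathcal H$ be nonempty, closed and convex; indices are cyclic, so $C_{N+1}:=C_1$ (and likewise for $T_{i,i+1}$, $d^i$ and $x^i$ below). Let $P_C$ denote the nearest point projection onto $C$, $R_C:=2P_C-I$, $\operatorname{Fix}T:=\{x:Tx=x\}$, and $$T_{i,i+1}:=\tfrac12\bigl(I+R_{C_{i+1}}R_{C_i}\bigr),\qquad T_{[\sigma_i]}:=T_{i-1,i}\cdots T_{i+1,i+2}T_{i,i+1}$$ (the composition of all $N$ operators in cyclic order, $T_{i,i+1}$ acting first). For $x_0\in\mathcal H$ let the cyclic Douglas–Rachford sequences be defined, for $n\ge1$ and $1\le i\le N$, by $$x_1^1:=x_0,\qquad x_n^{i+1}:=T_{i,i+1}x_n^i,\qquad x_{n+1}^1:=x_n^{N+1}.$$ Let $Q_1:=P_{C_1}P_{C_N}\cdots P_{C_2}$. If $\operatorname{Fix}Q_1\ne\emptyset$, the difference vectors are $d^i:=q^{i+1}-q^i$ ($1\le i\le N$), where $q^1\in\operatorname{Fix}Q_1$ and $q^{i+1}:=P_{C_{i+1}}q^i$.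 **Theorem (Cyclic Douglas–Rachford dichotomy).** For every $x_0\in\mathcal H$ the following hold. (a) For each $i=1,\dots,N$, $$P_{C_{i+1}}R_{C_i}x_n^i-P_{C_{i+1}}x_n^{i+1}=(x_n^{i+1}-x_n^i)-(P_{C_{i+1}}x_n^{i+1}-P_{C_i}x_n^i)\ \text{ for all }n,$$ and this converges to $0$ in norm as $n\to\infty$. (b) Exactly one of the following alternatives holds. (i) $\operatorname{Fix}T_{[\sigma_i]}$ is empty for every $i$. Then $\|x_n^i\|\to+\infty$ for every $i$. (ii) $\operatorname{Fix}T_{[\sigma_i]}$ is nonempty for every $i$. Then $\operatorname{Fix}Q_1\neq\emptyset$, the difference vectors $d^i$ do not depend on the choice of $q^1$, and there are points $x^1,\dots,x^N$ such that for every $i$: $x_n^i$ converges weakly to $x^i\in\operatorname{Fix}T_{[\sigma_i]}$, with $x^{i+1}=T_{i,i+1}x^i$ (where $x^{N+1}:=x^1$). Furthermore, for every $i$, in norm as $n\to\infty$, $$x_n^{i+1}-x_n^i=P_{C_{i+1}}R_{C_i}x_n^i-P_{C_i}x_n^i\to d^i,\qquad P_{C_{i+1}}x_n^{i+1}-P_{C_i}x_n^i\to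 d^i,$$ and $$x^{i+1}-x^i=P_{C_{i+1}}x^{i+1}-P_{C_i}x^i=d^i,\qquad P_{C_{i+1}}R_{C_i}x^i=P_{C_{i+1}}x^{i+1}.$$ -/

import Mathlib

open Filter Topology

namespace CyclicDR

noncomputable section

variable {H : Type*} [NormedAddCommGroup H] [InnerProductSpace ℝ H]

/-- `p` is a nearest point of `C` to `x`. -/
def IsNearest (C : Set H) (x p : H) : Prop :=
  p ∈ C ∧ ∀ c ∈ C, ‖p - x‖ ≤ ‖c - x‖

/-- The nearest point projection `P_C x`. The value `x`, used where `x` has no nearest point in `C`,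
never occurs for a nonempty closed convex set in a Hilbert space (see `proj_eq_iff`). -/
def proj (C : Set H) (x : H) : H :=
  open Classical in if h : ∃ p, IsNearest C x p then h.choose else x

theorem isNearest_iff {C : Set H} (hv : Convex ℝ C) {x p : H} :
    IsNearest C x p ↔ p ∈ C ∧ ∀ c ∈ C, inner ℝ (x - p) (c - p) ≤ 0 := by
  refine and_congr_right fun hp => ?_
  rw [← norm_eq_iInf_iff_real_inner_le_zero hv hp]
  have : Nonempty C := ⟨⟨p, hp⟩⟩
  have hb : BddBelow (Set.range fun w : C => ‖x - w‖) :=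
    ⟨0, by rintro _ ⟨w, rfl⟩; exact norm_nonneg _⟩
  constructor
  · intro h
    refine le_antisymm (le_ciInf fun w => ?_) (ciInf_le hb ⟨p, hp⟩)
    rw [norm_sub_rev x p, norm_sub_rev x]
    exact h w w.2
  · intro h c hc
    rw [norm_sub_rev p x, norm_sub_rev c x, h]
    exact ciInf_le hb ⟨c, hc⟩

/-- On nonempty closed convex sets of a Hilbert space, nearest points exist and are unique, and
`proj C x` is the nearest point. -/
theorem proj_eq_iff [CompleteSpace H] {C : Set H} (hne : C.Nonempty) (hc : IsClosed C)
    (hv : Convex ℝ C) {x p : H} : proj C x = p ↔ IsNearest C x p := by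
  have hex : ∃ p, IsNearest C x p := by
    obtain ⟨v, hvC, h⟩ := exists_norm_eq_iInf_of_complete_convex hne hc.isComplete hv x
    exact ⟨v, (isNearest_iff hv).2 ⟨hvC, (norm_eq_iInf_iff_real_inner_le_zero hv hvC).1 h⟩⟩
  have hs : IsNearest C x (proj C x) := by
    unfold proj
    rw [dif_pos hex]
    exact hex.choose_spec
  refine ⟨fun h => h ▸ hs, fun h => ?_⟩
  generalize proj C x = q at hs
  have h1 := (isNearest_iff hv).1 hs
  have h2 := (isNearest_iff hv).1 h
  have e1 := h1.2 p h2.1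
  have e2 := h2.2 q h1.1
  have e3 : inner ℝ (q - p) (q - p) = inner ℝ (x - q) (p - q) + inner ℝ (x - p) (q - p) := by
    simp only [inner_sub_left, inner_sub_right]
    ring
  have e4 : inner ℝ (q - p) (q - p) ≤ 0 := by linarith
  rw [real_inner_self_eq_norm_sq] at e4
  exact sub_eq_zero.1 (norm_eq_zero.1 (by nlinarith [norm_nonneg (q - p)]))

/-- The reflection `R_C = 2 P_C - I`. -/
def reflect (C : Set H) (x : H) : H := (2 : ℝ) • proj C x - x

/-- The Douglas-Rachford operator `T_{A,B} = (I + R_B R_A) / 2`. -/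
def drOp (A B : Set H) (x : H) : H := (1 / 2 : ℝ) • (x + reflect B (reflect A x))

variable {N : ℕ} [NeZero N]

/-- `steps S z k` applies the first `k` of the maps `S 0, S 1, …, S (N-1), S 0, S 1, …` (indices
modulo `N`) to `z`, starting with `S 0`. -/
def steps (S : Fin N → H → H) (z : H) : ℕ → H
  | 0 => z
  | k + 1 => S (Fin.ofNat N k) (steps S z k)

/-- The cyclic Douglas-Rachford operator `T_{[C 0, …, C (N-1)]}`, the composition
`T_{C (N-1), C 0} ∘ ⋯ ∘ T_{C 1, C 2} ∘ T_{C 0, C 1}`. Addition in `Fin N` is modulo `N`. -/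
def cyclicDR (C : Fin N → Set H) (z : H) : H :=
  steps (fun k => drOp (C k) (C (k + 1))) z N

/-- `T_{[σ_i]}`: the cyclic Douglas-Rachford operator of `C i, C (i+1), …, C (i+N-1)`. -/
def cyclicDRFrom (C : Fin N → Set H) (i : Fin N) : H → H :=
  cyclicDR fun k => C (i + k)

/-- The points `x_n^1`: the sweep `n + 1` starts where the sweep `n` ended. The sweeps are numbered
from `0`. -/
def drStart (C : Fin N → Set H) (x₀ : H) : ℕ → H
  | 0 => x₀
  | n + 1 => steps (fun k => drOp (C k) (C (k + 1))) (drStart C x₀ n) N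

/-- The cyclic Douglas-Rachford sequences `x_n^i`, with `n` and `i` counted from `0`: the value
after `i` steps of the sweep `n`. At `i = N` it is the first point of the next sweep. -/
def drSeq (C : Fin N → Set H) (x₀ : H) (n i : ℕ) : H :=
  steps (fun k => drOp (C k) (C (k + 1))) (drStart C x₀ n) i

/-- The cyclic projection operator `P_{C 0} P_{C (N-1)} ⋯ P_{C 1}` (`P_{C 1}` acts first), which
maps the term of the cyclic projection sequence in `C 0` to the next term in `C 0`. -/
def cyclicProj (C : Fin N → Set H) (z : H) : H :=
  steps (fun k => proj (C (k + 1))) z N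

/-- `d` is the family of difference vectors of the method of cyclic projections:
`d^i = q^{i+1} - q^i`, where `q^0` is a fixed point of `P_{C 0} P_{C (N-1)} ⋯ P_{C 1}` and
`q^{i+1} = P_{C (i+1)} q^i`. -/
def IsDifferenceVectors (C : Fin N → Set H) (d : Fin N → H) : Prop :=
  ∃ q ∈ Function.fixedPoints (cyclicProj C), ∀ i : Fin N,
    d i = steps (fun k => proj (C (k + 1))) q (i.val + 1) - steps (fun k => proj (C (k + 1))) q i.val

/-- Weak convergence of a sequence: convergence in Mathlib's weak topology. -/
def WeaklyTendsto (u : ℕ → H) (a : H) : Prop :=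
  Tendsto (fun n => toWeakSpace ℝ H (u n)) atTop (𝓝 (toWeakSpace ℝ H a))

end

end CyclicDR

namespace CyclicDR

/-! The proof compares orbits. Firm nonexpansiveness of T_{A,B} makes the distance between two
Douglas–Rachford orbits along the same sets nonincreasing and forces the difference of their
increments to 0 (`IsDROrbit.tendsto_step_sub`). On A the operator T_{A,B} is P_B, so successive
projections also form such an orbit, available for comparison even when no fixed point exists.

Suitably started cyclic projections are almost periodic (`exists_norm_projOrbit_sub_le`), so x (k+N)
- x k → 0 on every orbit (`IsDROrbit.tendsto_add_period_sub`). With this, an estimate for the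
shadows P x k that telescopes over one period gives (a) (`IsDROrbit.tendsto_proj_reflect_sub`).

For (b), asymptotic regularity and demiclosedness turn any bounded subsequence into a fixed point:
without fixed points the norms diverge, and with them Opial's argument gives a weak limit. That
limit starts a periodic orbit w. A periodic quantity that tends to 0 vanishes, so all periodic
orbits share their increments and the shadows of w form a cycle of projections; the increments of w
are therefore the difference vectors. -/

theorem tendsto_add_sub_of_tendsto_succ_sub {E : Type*} [NormedAddCommGroup E] {w : ℕ → E}
    (h : Tendsto (fun k => w (k + 1) - w k) atTop (𝓝 0)) (N : ℕ) :
    Tendsto (fun k => w (k + N) - w k) atTop (𝓝 0) := by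
  induction N with
  | zero => simp
  | succ N ih =>
    have := ((tendsto_add_atTop_iff_nat N).2 h).add ih
    rw [add_zero] at this
    refine this.congr fun k => ?_
    rw [show k + (N + 1) = k + N + 1 by ring]
    abel

variable {H : Type*} [NormedAddCommGroup H] [InnerProductSpace ℝ H]

/-- Nonempty closed convex sets. -/
structure IsClosedConvex (C : Set H) : Prop where
  nonempty : C.Nonempty
  isClosed : IsClosed C
  convex : Convex ℝ C

theorem reflect_def (C : Set H) (x : H) : reflect C x = (2 : ℝ) • proj C x - x := rfl

theorem drOp_eq (A B : Set H) (x : H) :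
    drOp A B x = x + (proj B (reflect A x) - proj A x) := by
  unfold drOp
  rw [reflect_def B, reflect_def A]
  module

/-! ### Projections and firm nonexpansiveness -/

section Projection

variable [CompleteSpace H]

theorem proj_mem {C : Set H} (hC : IsClosedConvex C) (x : H) : proj C x ∈ C :=
  ((proj_eq_iff hC.nonempty hC.isClosed hC.convex).1 rfl).1

theorem inner_proj_le {C : Set H} (hC : IsClosedConvex C) (x : H) {c : H} (hc : c ∈ C) :
    inner ℝ (x - proj C x) (c - proj C x) ≤ 0 :=
  ((isNearest_iff hC.convex).1 ((proj_eq_iff hC.nonempty hC.isClosed hC.convex).1 rfl)).2 c hc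

theorem proj_eq_of_inner_le {C : Set H} (hC : IsClosedConvex C) {x p : H} (hp : p ∈ C)
    (h : ∀ c ∈ C, inner ℝ (x - p) (c - p) ≤ 0) : proj C x = p :=
  (proj_eq_iff hC.nonempty hC.isClosed hC.convex).2 ((isNearest_iff hC.convex).2 ⟨hp, h⟩)

theorem proj_of_mem {C : Set H} (hC : IsClosedConvex C) {x : H} (hx : x ∈ C) : proj C x = x :=
  proj_eq_of_inner_le hC hx (by simp)

/-- Monotonicity of the normal cone operator, along projections. -/
theorem inner_proj_sub_proj_nonneg {C : Set H} (hC : IsClosedConvex C) (x y : H) :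
    0 ≤ inner ℝ (proj C x - proj C y) ((x - proj C x) - (y - proj C y)) := by
  have h1 := inner_proj_le hC x (proj_mem hC y)
  have h2 := inner_proj_le hC y (proj_mem hC x)
  generalize proj C x = p at *
  generalize proj C y = q at *
  have : inner ℝ (p - q) ((x - p) - (y - q)) = - inner ℝ (x - p) (q - p) - inner ℝ (y - q) (p - q) := by
    rw [inner_sub_right, real_inner_comm, real_inner_comm (y - q), ← neg_sub p q, inner_neg_right]
    ring
  linarith

theorem norm_proj_sub_proj_le {C : Set H} (hC : IsClosedConvex C) (x y : H) :
    ‖proj C x - proj C y‖ ≤ ‖x - y‖ := by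
  have h := inner_proj_sub_proj_nonneg hC x y
  have e : x - y = (proj C x - proj C y) + ((x - proj C x) - (y - proj C y)) := by abel
  have h2 := norm_add_sq_real (proj C x - proj C y) ((x - proj C x) - (y - proj C y))
  rw [← e] at h2
  exact le_of_sq_le_sq (by nlinarith [sq_nonneg ‖(x - proj C x) - (y - proj C y)‖]) (norm_nonneg _)

theorem drOp_of_mem {A : Set H} (hA : IsClosedConvex A) (B : Set H) {x : H} (hx : x ∈ A) :
    drOp A B x = proj B x := by
  rw [drOp_eq, reflect_def, proj_of_mem hA hx]
  have : (2 : ℝ) • x - x = x := by module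
  rw [this]; abel

/-- Firm nonexpansiveness of the Douglas-Rachford operator, with the contribution of the first
projection kept. -/
theorem drOp_firm (A : Set H) {B : Set H} (hB : IsClosedConvex B) (x y : H) :
    ‖drOp A B x - drOp A B y‖ ^ 2 + ‖(drOp A B x - x) - (drOp A B y - y)‖ ^ 2
      + 2 * inner ℝ (proj A x - proj A y) ((x - proj A x) - (y - proj A y)) ≤ ‖x - y‖ ^ 2 := by
  have h := inner_proj_sub_proj_nonneg hB (reflect A x) (reflect A y)
  rw [drOp_eq, drOp_eq]
  generalize proj B (reflect A x) = r at *
  generalize proj B (reflect A y) = s at *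
  rw [reflect_def, reflect_def] at h
  generalize proj A x = p at *
  generalize proj A y = q at *
  -- In these variables the claim is ‖c + a‖² + ‖c - b‖² + 2⟨b, a⟩ ≤ ‖b + a‖², and the two sides
  -- differ by exactly 2⟨c, b - a - c⟩, which `h` makes nonnegative.
  obtain ⟨a, ha⟩ : ∃ a, a = (x - p) - (y - q) := ⟨_, rfl⟩
  obtain ⟨b, hb⟩ : ∃ b, b = p - q := ⟨_, rfl⟩
  obtain ⟨c, hc⟩ : ∃ c, c = r - s := ⟨_, rfl⟩
  rw [show x + (r - p) - (y + (s - q)) = c + a by rw [hc, ha]; abel,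
    show x + (r - p) - x - (y + (s - q) - y) = c - b by rw [hb, hc]; abel,
    ← hb, ← ha, show x - y = b + a by rw [hb, ha]; abel]
  rw [show (2 : ℝ) • p - x - r - ((2 : ℝ) • q - y - s) = b - a - c by rw [ha, hb, hc]; module,
    ← hc] at h
  rw [norm_add_sq_real, norm_add_sq_real, norm_sub_sq_real]
  rw [inner_sub_right, inner_sub_right, real_inner_self_eq_norm_sq] at h
  linarith

theorem norm_drOp_sub_drOp_le {A B : Set H} (hA : IsClosedConvex A) (hB : IsClosedConvex B)
    (x y : H) : ‖drOp A B x - drOp A B y‖ ≤ ‖x - y‖ := by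
  have h := drOp_firm A hB x y
  have h1 := inner_proj_sub_proj_nonneg hA x y
  exact le_of_sq_le_sq (by nlinarith [sq_nonneg ‖(drOp A B x - x) - (drOp A B y - y)‖])
    (norm_nonneg _)

end Projection

/-! ### Comparison of two Douglas–Rachford orbits -/

section Orbits

/-- `x` is a Douglas-Rachford orbit along the sequence of sets `A`. -/
def IsDROrbit (A : ℕ → Set H) (x : ℕ → H) : Prop :=
  ∀ k, x (k + 1) = drOp (A k) (A (k + 1)) (x k)

theorem IsDROrbit.shift {A : ℕ → Set H} {x : ℕ → H} (hx : IsDROrbit A x) {N : ℕ}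
    (hA : ∀ k, A (k + N) = A k) : IsDROrbit A fun k => x (k + N) := by
  intro k
  have := hx (k + N)
  rw [hA, add_right_comm, hA] at this
  exact this

variable [CompleteSpace H] {A : ℕ → Set H} {x y : ℕ → H}

theorem IsDROrbit.antitone_norm_sub (hA : ∀ k, IsClosedConvex (A k)) (hx : IsDROrbit A x)
    (hy : IsDROrbit A y) : Antitone fun k => ‖x k - y k‖ :=
  antitone_nat_of_succ_le fun k => by
    rw [hx, hy]; exact norm_drOp_sub_drOp_le (hA _) (hA _) _ _

theorem IsDROrbit.tendsto_norm_sub_sq_diff (hA : ∀ k, IsClosedConvex (A k)) (hx : IsDROrbit A x)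
    (hy : IsDROrbit A y) :
    Tendsto (fun k => ‖x k - y k‖ ^ 2 - ‖x (k + 1) - y (k + 1)‖ ^ 2) atTop (𝓝 0) := by
  have hanti := hx.antitone_norm_sub hA hy
  have hl := (tendsto_atTop_ciInf hanti ⟨0, by rintro _ ⟨k, rfl⟩; positivity⟩).pow 2
  simpa using hl.sub ((tendsto_add_atTop_iff_nat 1).2 hl)

theorem IsDROrbit.tendsto_step_sub (hA : ∀ k, IsClosedConvex (A k)) (hx : IsDROrbit A x)
    (hy : IsDROrbit A y) :
    Tendsto (fun k => (x (k + 1) - x k) - (y (k + 1) - y k)) atTop (𝓝 0) := by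
  have h2 : Tendsto (fun k => ‖(x (k + 1) - x k) - (y (k + 1) - y k)‖ ^ 2) atTop (𝓝 0) := by
    refine squeeze_zero (fun _ => by positivity) (fun k => ?_) (hx.tendsto_norm_sub_sq_diff hA hy)
    have h := drOp_firm (A k) (hA (k + 1)) (x k) (y k)
    have h1 := inner_proj_sub_proj_nonneg (hA k) (x k) (y k)
    rw [← hx, ← hy] at h
    linarith
  rw [tendsto_zero_iff_norm_tendsto_zero]
  simpa [Real.sqrt_sq] using h2.sqrt

theorem IsDROrbit.tendsto_inner_proj (hA : ∀ k, IsClosedConvex (A k)) (hx : IsDROrbit A x)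
    (hy : IsDROrbit A y) :
    Tendsto (fun k => inner ℝ (proj (A k) (x k) - proj (A k) (y k))
      ((x k - proj (A k) (x k)) - (y k - proj (A k) (y k)))) atTop (𝓝 0) := by
  refine squeeze_zero (fun k => inner_proj_sub_proj_nonneg (hA k) _ _) (fun k => ?_)
    (hx.tendsto_norm_sub_sq_diff hA hy)
  have h := drOp_firm (A k) (hA (k + 1)) (x k) (y k)
  have h1 := inner_proj_sub_proj_nonneg (hA k) (x k) (y k)
  rw [← hx, ← hy] at h
  nlinarith [sq_nonneg ‖(x (k + 1) - x k) - (y (k + 1) - y k)‖]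

end Orbits

/-! ### Asymptotic regularity over one period -/

section Regularity

variable [CompleteSpace H] {A : ℕ → Set H} {N : ℕ}

/-- The orbit of `z` under the successive projections onto `A 1, A 2, …`, each preceded by scaling
with `t`. -/
noncomputable def projOrbit (A : ℕ → Set H) (t : ℝ) (z : H) : ℕ → H
  | 0 => z
  | k + 1 => proj (A (k + 1)) (t • projOrbit A t z k)

theorem norm_projOrbit_sub_le (hA : ∀ k, IsClosedConvex (A k)) {t : ℝ} (ht : 0 ≤ t) (z w : H)
    (k : ℕ) : ‖projOrbit A t z k - projOrbit A t w k‖ ≤ t ^ k * ‖z - w‖ := by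
  induction k with
  | zero => simp [projOrbit]
  | succ k ih =>
    calc _ ≤ ‖t • projOrbit A t z k - t • projOrbit A t w k‖ := norm_proj_sub_proj_le (hA _) _ _
      _ = t * ‖projOrbit A t z k - projOrbit A t w k‖ := by
        rw [← smul_sub, norm_smul, Real.norm_of_nonneg ht]
      _ ≤ t * (t ^ k * ‖z - w‖) := by gcongr
      _ = _ := by ring

theorem projOrbit_mem (hA : ∀ k, IsClosedConvex (A k)) (t : ℝ) {z : H} (hz : z ∈ A 0) (k : ℕ) :
    projOrbit A t z k ∈ A k := by
  cases k with
  | zero => exact hz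
  | succ k => exact proj_mem (hA _) _

theorem isDROrbit_projOrbit (hA : ∀ k, IsClosedConvex (A k)) {z : H} (hz : z ∈ A 0) :
    IsDROrbit A (projOrbit A 1 z) := fun k => by
  rw [drOp_of_mem (hA k) _ (projOrbit_mem hA 1 hz k), projOrbit, one_smul]

/-- Scaling by t < 1 makes one sweep a contraction with constant t ^ N. The unscaled sweep need not
have a fixed point. -/
theorem exists_projOrbit_eq (hA : ∀ k, IsClosedConvex (A k)) (hN : N ≠ 0) {t : ℝ} (ht : 0 ≤ t)
    (ht1 : t < 1) : ∃ z, projOrbit A t z N = z := by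
  lift t to NNReal using ht
  have hc : ContractingWith (t ^ N) fun z => projOrbit A (t : ℝ) z N := by
    refine ⟨pow_lt_one₀ zero_le (by exact_mod_cast ht1) hN,
      LipschitzWith.of_dist_le_mul fun z w => ?_⟩
    rw [dist_eq_norm, dist_eq_norm, NNReal.coe_pow]
    exact norm_projOrbit_sub_le hA t.coe_nonneg z w N
  exact ⟨_, hc.fixedPoint_isFixedPt⟩

/-- An energy estimate whose second summand telescopes along a cycle and whose bound does not depend
on η. With p the projection, it is twice the projection inequality at c combined with η‖p - c‖² + (1
- η)‖p - z - c‖² ≥ 0. -/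
theorem mul_norm_sq_proj_smul_le {C : Set H} (hC : IsClosedConvex C) {c : H} (hc : c ∈ C)
    {η : ℝ} (h0 : 0 ≤ η) (h1 : η ≤ 1) (z : H) :
    η * ‖proj C ((1 - η) • z)‖ ^ 2 + (1 - η) * (‖proj C ((1 - η) • z)‖ ^ 2 - ‖z‖ ^ 2)
      ≤ ‖c‖ ^ 2 := by
  have h := inner_proj_le hC ((1 - η) • z) hc
  generalize proj C ((1 - η) • z) = p at *
  have e1 := norm_sub_sq_real p c
  have e2 := norm_sub_sq_real (p - z) c
  have e3 := norm_sub_sq_real p z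
  simp only [inner_sub_left, inner_sub_right, real_inner_smul_left,
    real_inner_self_eq_norm_sq] at h e2
  rw [real_inner_comm p z] at h
  nlinarith [mul_nonneg h0 (sq_nonneg ‖p - c‖),
    mul_nonneg (sub_nonneg.2 h1) (sq_nonneg ‖p - z - c‖)]

/-- The cyclic projection operator has zero minimal displacement. -/
theorem exists_norm_projOrbit_sub_le (hA : ∀ k, IsClosedConvex (A k)) (hN : N ≠ 0)
    (hper : A N = A 0) {ε : ℝ} (hε : 0 < ε) :
    ∃ z ∈ A 0, ‖projOrbit A 1 z N - z‖ ≤ ε := by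
  choose c hc using fun k => (hA k).nonempty
  set K : ℝ := ∑ k ∈ Finset.range N, ‖c (k + 1)‖ ^ 2 with hK
  have hK0 : 0 ≤ K := Finset.sum_nonneg fun _ _ => by positivity
  obtain ⟨η, h0, h1, h2⟩ : ∃ η : ℝ, 0 < η ∧ η ≤ 1 ∧ η * (N * K) ≤ ε ^ 2 := by
    -- The +1 keeps the denominator positive when K = 0.
    refine ⟨min 1 (ε ^ 2 / (N * K + 1)), by positivity, min_le_left _ _, ?_⟩
    calc _ ≤ ε ^ 2 / (N * K + 1) * (N * K + 1) :=
          mul_le_mul (min_le_right _ _) (by linarith) (by positivity) (by positivity)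
      _ = ε ^ 2 := by field_simp
  obtain ⟨z, hz⟩ := exists_projOrbit_eq hA hN (t := 1 - η) (by linarith) (by linarith)
  have hz0 : z ∈ A 0 := by
    rw [← hper, ← hz]
    obtain ⟨m, rfl⟩ := Nat.exists_eq_succ_of_ne_zero hN
    exact proj_mem (hA _) _
  set p := projOrbit A (1 - η) z with hp
  have hp0 : p 0 = z := rfl
  have hps : ∀ k, p (k + 1) = proj (A (k + 1)) ((1 - η) • p k) := fun _ => rfl
  -- The scaled orbit closes up, p N = p 0, so the telescoping part of the energy estimate sums to
  -- 0.
  have hsum : η * ∑ k ∈ Finset.range N, ‖p (k + 1)‖ ^ 2 ≤ K := by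
    have h : ∑ k ∈ Finset.range N, (η * ‖p (k + 1)‖ ^ 2
        + (1 - η) * (‖p (k + 1)‖ ^ 2 - ‖p k‖ ^ 2)) ≤ K :=
      Finset.sum_le_sum fun k _ => mul_norm_sq_proj_smul_le (hA (k + 1)) (hc _) h0.le h1 (p k)
    rw [Finset.sum_add_distrib, ← Finset.mul_sum, ← Finset.mul_sum,
      Finset.sum_range_sub (fun k => ‖p k‖ ^ 2), hz, hp0] at h
    linarith
  have hshift : ∑ k ∈ Finset.range N, ‖p (k + 1)‖ ^ 2 = ∑ k ∈ Finset.range N, ‖p k‖ ^ 2 := by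
    have := Finset.sum_range_sub (fun k => ‖p k‖ ^ 2) N
    rw [Finset.sum_sub_distrib, hz, hp0] at this
    linarith
  -- Dropping the factor 1 - η at step j costs at most η‖p j‖, and projections do not amplify
  -- earlier errors.
  have hdist : ∀ k, ‖projOrbit A 1 z k - p k‖ ≤ ∑ j ∈ Finset.range k, η * ‖p j‖ := by
    intro k
    induction k with
    | zero => simp [projOrbit, hp]
    | succ k ih =>
      rw [Finset.sum_range_succ, hps, projOrbit]
      calc _ ≤ ‖(1 : ℝ) • projOrbit A 1 z k - (1 - η) • p k‖ := norm_proj_sub_proj_le (hA _) _ _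
        _ = ‖(projOrbit A 1 z k - p k) + η • p k‖ := by congr 1; module
        _ ≤ ‖projOrbit A 1 z k - p k‖ + ‖η • p k‖ := norm_add_le _ _
        _ = ‖projOrbit A 1 z k - p k‖ + η * ‖p k‖ := by
          rw [norm_smul, Real.norm_of_nonneg h0.le]
        _ ≤ _ := by gcongr
  refine ⟨z, hz0, ?_⟩
  have hd := hdist N
  rw [hz, ← Finset.mul_sum] at hd
  refine hd.trans (le_of_sq_le_sq ?_ hε.le)
  -- Cauchy–Schwarz gives (η ∑ ‖p k‖)² ≤ η N · (η ∑ ‖p k‖²) ≤ η N K.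
  have hcs := sq_sum_le_card_mul_sum_sq (s := Finset.range N) (f := fun k => ‖p k‖)
  rw [Finset.card_range] at hcs
  rw [hshift] at hsum
  calc _ = η ^ 2 * (∑ i ∈ Finset.range N, ‖p i‖) ^ 2 := by ring
    _ ≤ η ^ 2 * (N * ∑ i ∈ Finset.range N, ‖p i‖ ^ 2) := by gcongr
    _ = η * (N * (η * ∑ i ∈ Finset.range N, ‖p i‖ ^ 2)) := by ring
    _ ≤ η * (N * K) := by gcongr
    _ ≤ _ := h2

/-- Asymptotic regularity of the cyclic Douglas-Rachford method, with or without fixed points. -/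
theorem IsDROrbit.tendsto_add_period_sub {x : ℕ → H} (hA : ∀ k, IsClosedConvex (A k)) (hN : N ≠ 0)
    (hper : ∀ k, A (k + N) = A k) (hx : IsDROrbit A x) :
    Tendsto (fun k => x (k + N) - x k) atTop (𝓝 0) := by
  rw [Metric.tendsto_atTop]
  intro ε hε
  obtain ⟨z, hz, hzε⟩ := exists_norm_projOrbit_sub_le hA hN (by simpa using hper 0) (half_pos hε)
  set y := projOrbit A 1 z with hy_def
  have hy : IsDROrbit A y := isDROrbit_projOrbit hA hz
  -- `y` and its shift by one period are both orbits, so their initial distance bounds all later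
  -- ones.
  have hyε : ∀ k, ‖y (k + N) - y k‖ ≤ ε / 2 := fun k =>
    ((hy.shift hper).antitone_norm_sub hA hy (Nat.zero_le k)).trans
      (by simpa [hy_def, projOrbit] using hzε)
  have h := tendsto_add_sub_of_tendsto_succ_sub (w := fun k => x k - y k)
    ((hx.tendsto_step_sub hA hy).congr fun k => by abel) N
  obtain ⟨K, hK⟩ := Metric.tendsto_atTop.1 h (ε / 2) (half_pos hε)
  refine ⟨K, fun k hk => ?_⟩
  have h1 := hK k hk
  rw [dist_zero_right] at h1 ⊢
  calc _ = ‖(x (k + N) - y (k + N) - (x k - y k)) + (y (k + N) - y k)‖ := by congr 1; abel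
    _ ≤ _ := norm_add_le _ _
    _ < ε := by linarith [hyε k]

end Regularity

/-! ### Regularity of the shadows, for part (a) -/

section ShadowRegularity

theorem tendsto_inner_zero_of_bounded {u v : ℕ → H} (hu : Tendsto u atTop (𝓝 0)) {M : ℝ}
    (hv : ∀ k, ‖v k‖ ≤ M) : Tendsto (fun k => inner ℝ (u k) (v k)) atTop (𝓝 0) := by
  refine squeeze_zero_norm (a := fun k => ‖u k‖ * M) (fun k => ?_) ?_
  · exact (norm_inner_le_norm _ _).trans (by gcongr; exact hv k)
  · simpa using hu.norm.mul_const M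

theorem drOp_sub_self (A B : Set H) (x : H) :
    drOp A B x - x = proj B (reflect A x) - proj A x := by
  rw [drOp_eq]; abel

theorem proj_reflect_sub_proj_drOp (A B : Set H) (x : H) :
    proj B (reflect A x) - proj B (drOp A B x)
      = (drOp A B x - x) - (proj B (drOp A B x) - proj A x) := by
  rw [drOp_sub_self]; abel

variable [CompleteSpace H] {A : ℕ → Set H} {N : ℕ}

/-- Here `p = P_A x` and `a = x - p`, while `r = P_B R_A x` and `s = P_B T x`, so that
`T x = r + a`; the point `y` lies in `A` and `y' = P_B y`. -/
theorem norm_sq_proj_reflect_sub_le {A B : Set H} (hB : IsClosedConvex B) (x y y' : H) :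
    ‖proj B (reflect A x) - proj B (drOp A B x)‖ ^ 2 ≤
      ‖proj B (drOp A B x) - y'‖ ^ 2 - ‖proj B (reflect A x) - y'‖ ^ 2
      + 2 * (inner ℝ (drOp A B x - proj B (drOp A B x)) (proj B (drOp A B x) - y')
        - inner ℝ (x - proj A x) (proj A x - y)
        - inner ℝ ((drOp A B x - x) - (y' - y)) (x - proj A x)) := by
  have h := inner_proj_le hB (drOp A B x) (proj_mem hB (reflect A x))
  have e := drOp_sub_self A B x
  generalize proj B (reflect A x) = r at *
  generalize proj B (drOp A B x) = s at *
  generalize drOp A B x = t at *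
  generalize proj A x = p at *
  obtain rfl : t = r - p + x := eq_add_of_sub_eq e
  have e1 : ‖r - s‖ ^ 2 = ‖s - y'‖ ^ 2 - ‖r - y'‖ ^ 2 + 2 * inner ℝ (r - s) (r - y') := by
    rw [show s - y' = (r - y') - (r - s) by abel, norm_sub_sq_real (r - y'),
      real_inner_comm (r - s)]
    ring
  -- The first term on the right is nonpositive because r lies in B and s is the projection of T x
  -- onto B.
  have e2 : inner ℝ (r - s) (r - y') = inner ℝ (r - p + x - s) (r - s)
      + inner ℝ (r - p + x - s) (s - y') - inner ℝ (x - p) (p - y)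
      - inner ℝ (r - p + x - x - (y' - y)) (x - p) := by
    rw [show r - p + x - s = (r - s) + (x - p) by abel,
      show r - p + x - x - (y' - y) = (r - y') - (p - y) by abel,
      show s - y' = (r - y') - (r - s) by abel]
    generalize r - s = u, r - y' = v, x - p = a, p - y = q
    rw [inner_add_left, inner_add_left, inner_sub_right, inner_sub_right, inner_sub_left,
      real_inner_comm a v, real_inner_comm a q]
    ring
  linarith

theorem IsDROrbit.tendsto_proj_reflect_sub {x : ℕ → H} (hA : ∀ k, IsClosedConvex (A k))
    (hN : N ≠ 0) (hper : ∀ k, A (k + N) = A k) (hx : IsDROrbit A x) :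
    Tendsto (fun k => proj (A (k + 1)) (reflect (A k) (x k)) - proj (A (k + 1)) (x (k + 1)))
      atTop (𝓝 0) := by
  obtain ⟨z, hz⟩ := (hA 0).nonempty
  set y := projOrbit A 1 z with hy_def
  have hy : IsDROrbit A y := isDROrbit_projOrbit hA hz
  have hyA : ∀ k, y k ∈ A k := projOrbit_mem hA 1 hz
  have hPy : ∀ k, proj (A k) (y k) = y k := fun k => proj_of_mem (hA k) (hyA k)
  set M := ‖x 0 - y 0‖
  set p : ℕ → H := fun k => proj (A k) (x k) with hp
  set a : ℕ → H := fun k => x k - p k with ha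
  set r : ℕ → H := fun k => proj (A (k + 1)) (reflect (A k) (x k)) with hr
  have hxy : ∀ k, ‖x k - y k‖ ≤ M := fun k => hx.antitone_norm_sub hA hy (Nat.zero_le k)
  have hpy : ∀ k, ‖p k - y k‖ ≤ M := fun k => by
    have := norm_proj_sub_proj_le (hA k) (x k) (y k)
    rw [hPy] at this
    exact this.trans (hxy k)
  have hab : ∀ k, ‖a k‖ ≤ M + M := fun k => by
    calc ‖a k‖ = ‖(x k - y k) - (p k - y k)‖ := by rw [sub_sub_sub_cancel_right]
      _ ≤ _ := (norm_sub_le _ _).trans (add_le_add (hxy k) (hpy k))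
  have hδ : Tendsto (fun k => (x (k + 1) - x k) - (y (k + 1) - y k)) atTop (𝓝 0) :=
    hx.tendsto_step_sub hA hy
  have hap : Tendsto (fun k => inner ℝ (a k) (p k - y k)) atTop (𝓝 0) := by
    refine (hx.tendsto_inner_proj hA hy).congr fun k => ?_
    rw [hPy, sub_self, sub_zero, real_inner_comm]
  have hrp : ∀ k, r k - y (k + 1) = (p k - y k) + ((x (k + 1) - x k) - (y (k + 1) - y k)) := by
    intro k
    have := drOp_sub_self (A k) (A (k + 1)) (x k)
    rw [← hx] at this
    rw [this]
    simp only [hr, hp]; abel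
  -- the error terms
  have hE : Tendsto (fun k => -2 * inner ℝ ((x (k + 1) - x k) - (y (k + 1) - y k)) (p k - y k)
      - ‖(x (k + 1) - x k) - (y (k + 1) - y k)‖ ^ 2
      + 2 * (inner ℝ (a (k + 1)) (p (k + 1) - y (k + 1)) - inner ℝ (a k) (p k - y k)
        - inner ℝ ((x (k + 1) - x k) - (y (k + 1) - y k)) (a k))) atTop (𝓝 0) := by
    have h1 := (tendsto_inner_zero_of_bounded hδ hpy).const_mul (-2)
    have h2 := hδ.norm.pow 2
    have h3 := (((tendsto_add_atTop_iff_nat 1).2 hap).sub hap).sub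
      (tendsto_inner_zero_of_bounded hδ hab)
    simpa using (h1.sub h2).add (h3.const_mul 2)
  set E : ℕ → ℝ := fun k => -2 * inner ℝ ((x (k + 1) - x k) - (y (k + 1) - y k)) (p k - y k)
      - ‖(x (k + 1) - x k) - (y (k + 1) - y k)‖ ^ 2
      + 2 * (inner ℝ (a (k + 1)) (p (k + 1) - y (k + 1)) - inner ℝ (a k) (p k - y k)
        - inner ℝ ((x (k + 1) - x k) - (y (k + 1) - y k)) (a k)) with hE_def
  -- By `hrp`, ‖r k - y (k+1)‖² is ‖p k - y k‖² up to terms collected in `E`; the bound then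
  -- telescopes.
  have hmain : ∀ k, ‖r k - p (k + 1)‖ ^ 2 ≤
      ‖p (k + 1) - y (k + 1)‖ ^ 2 - ‖p k - y k‖ ^ 2 + E k := by
    intro k
    have h := norm_sq_proj_reflect_sub_le (A := A k) (hA (k + 1)) (x k) (y k) (y (k + 1))
    rw [← hx] at h
    have e := norm_add_sq_real (p k - y k) ((x (k + 1) - x k) - (y (k + 1) - y k))
    rw [← hrp, real_inner_comm] at e
    simp only [hr, hp, ha, hE_def] at h e ⊢
    linarith
  -- Only the first square is kept on the left; the others are nonnegative.
  have hsum : ∀ n k, ‖r k - p (k + 1)‖ ^ 2 ≤ ‖p (k + (n + 1)) - y (k + (n + 1))‖ ^ 2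
      - ‖p k - y k‖ ^ 2 + ∑ j ∈ Finset.range (n + 1), E (k + j) := by
    intro n k
    induction n with
    | zero => simpa using hmain k
    | succ n ih =>
      rw [Finset.sum_range_succ]
      have := hmain (k + (n + 1))
      rw [add_assoc k] at this
      nlinarith [sq_nonneg ‖r (k + (n + 1)) - p (k + (n + 1 + 1))‖]
  obtain ⟨n, rfl⟩ := Nat.exists_eq_succ_of_ne_zero hN
  have hEs : Tendsto (fun k => ∑ j ∈ Finset.range (n + 1), E (k + j)) atTop (𝓝 0) := by
    simpa using tendsto_finsetSum (Finset.range (n + 1))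
      fun j _ => (tendsto_add_atTop_iff_nat j).2 hE
  have hpN : Tendsto (fun k => p (k + (n + 1)) - p k) atTop (𝓝 0) := by
    refine squeeze_zero_norm (fun k => ?_)
      (tendsto_zero_iff_norm_tendsto_zero.1 (hx.tendsto_add_period_sub hA hN hper))
    simp only [hp, hper k]
    exact norm_proj_sub_proj_le (hA k) _ _
  have hd : Tendsto (fun k => (p (k + (n + 1)) - y (k + (n + 1))) - (p k - y k)) atTop (𝓝 0) := by
    have := hpN.sub (hy.tendsto_add_period_sub hA hN hper)
    rw [sub_zero] at this
    exact this.congr fun k => sub_sub_sub_comm _ _ _ _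
  -- The difference of squares is ‖d‖² + 2⟨d, p k - y k⟩, where d is the null sequence of `hd` and p
  -- k - y k is bounded.
  have hq : Tendsto (fun k => ‖p (k + (n + 1)) - y (k + (n + 1))‖ ^ 2 - ‖p k - y k‖ ^ 2)
      atTop (𝓝 0) := by
    have h1 := (tendsto_inner_zero_of_bounded hd hpy).const_mul 2
    have h2 := (hd.norm.pow 2).add h1
    refine (by simpa using h2 : Tendsto _ atTop (𝓝 (0 : ℝ))).congr fun k => ?_
    have := norm_add_sq_real ((p (k + (n + 1)) - y (k + (n + 1))) - (p k - y k)) (p k - y k)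
    rw [sub_add_cancel] at this
    linarith
  have h0 : Tendsto (fun k => ‖r k - p (k + 1)‖ ^ 2) atTop (𝓝 0) :=
    squeeze_zero (fun _ => by positivity) (hsum n) (by simpa using hq.add hEs)
  rw [tendsto_zero_iff_norm_tendsto_zero]
  simpa [Real.sqrt_sq] using h0.sqrt

end ShadowRegularity

/-! ### Demiclosedness, weak compactness and Opial's theorem -/

section Weak

/-- Demiclosedness of `I - T` at `0` for nonexpansive `T`. -/
theorem eq_of_tendsto_inner_of_tendsto_sub {α : Type*} {F : Filter α} [F.NeBot] {T : H → H}
    (hT : ∀ x y, ‖T x - T y‖ ≤ ‖x - y‖) {u : α → H} {a : H} {M : ℝ} (hu : ∀ᶠ n in F, ‖u n‖ ≤ M)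
    (ha : ∀ h, Tendsto (fun n => inner ℝ h (u n)) F (𝓝 (inner ℝ h a)))
    (hd : Tendsto (fun n => T (u n) - u n) F (𝓝 0)) : T a = a := by
  have h1 : ∀ᶠ n in F, ‖a - T a‖ ^ 2 ≤ ‖T (u n) - u n‖ ^ 2 + 2 * ‖T (u n) - u n‖ * (M + ‖a‖)
      - 2 * (inner ℝ (a - T a) (u n) - inner ℝ (a - T a) a) := by
    filter_upwards [hu] with n hn
    have e1 : ‖u n - a‖ ≤ M + ‖a‖ := (norm_sub_le _ _).trans (by linarith)
    have e2 : ‖u n - T a‖ ≤ ‖T (u n) - u n‖ + ‖u n - a‖ := by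
      calc _ = ‖(T (u n) - T a) - (T (u n) - u n)‖ := by rw [sub_sub_sub_cancel_left]
        _ ≤ _ := norm_sub_le _ _
        _ ≤ _ := by linarith [hT (u n) a]
    -- Together with `e4`, this lets ‖u n - a‖² cancel, which leaves a bound on ‖a - T a‖² that
    -- tends to 0.
    have e3 := norm_add_sq_real (u n - a) (a - T a)
    rw [sub_add_sub_cancel, real_inner_comm, inner_sub_right] at e3
    have e4 : ‖u n - T a‖ ^ 2 ≤ (‖T (u n) - u n‖ + ‖u n - a‖) ^ 2 := by gcongr
    nlinarith [mul_le_mul_of_nonneg_left e1 (norm_nonneg (T (u n) - u n))]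
  have h2 : Tendsto (fun n => ‖T (u n) - u n‖ ^ 2 + 2 * ‖T (u n) - u n‖ * (M + ‖a‖)
      - 2 * (inner ℝ (a - T a) (u n) - inner ℝ (a - T a) a)) F (𝓝 0) := by
    have := (((hd.norm.pow 2).add ((hd.norm.const_mul 2).mul_const (M + ‖a‖))).sub
      (((ha (a - T a)).sub_const (inner ℝ (a - T a) a)).const_mul 2))
    simpa using this
  have h3 := ge_of_tendsto h2 h1
  exact (sub_eq_zero.1 (norm_eq_zero.1 (by nlinarith [norm_nonneg (a - T a)]))).symm

theorem weaklyTendsto_iff [CompleteSpace H] {u : ℕ → H} {a : H} :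
    WeaklyTendsto u a ↔ ∀ h, Tendsto (fun n => inner ℝ h (u n)) atTop (𝓝 (inner ℝ h a)) := by
  refine (WeakBilin.tendsto_iff_forall_eval_tendsto (B := (topDualPairing ℝ H).flip) ?_).trans
    ⟨fun h v => h (InnerProductSpace.toDual ℝ H v), fun h f => ?_⟩
  · intro v w hvw
    refine ext_inner_left ℝ fun h => ?_
    exact LinearMap.congr_fun hvw (InnerProductSpace.toDual ℝ H h)
  · have := h ((InnerProductSpace.toDual ℝ H).symm f)
    simp only [InnerProductSpace.toDual_symm_apply] at this
    exact this

variable [CompleteSpace H]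

/-- Weak sequential compactness of bounded sets, along ultrafilters. -/
theorem exists_tendsto_inner_of_bounded {α : Type*} (U : Ultrafilter α) {u : α → H} {M : ℝ}
    (hu : ∀ᶠ n in U, ‖u n‖ ≤ M) :
    ∃ a, ∀ h, Tendsto (fun n => inner ℝ h (u n)) U (𝓝 (inner ℝ h a)) := by
  let φ : α → WeakDual ℝ H := fun n => StrongDual.toWeakDual (InnerProductSpace.toDual ℝ H (u n))
  have hmem : ∀ᶠ n in U,
      φ n ∈ WeakDual.toStrongDual ⁻¹' Metric.closedBall (0 : StrongDual ℝ H) M := by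
    filter_upwards [hu] with n hn
    rw [Set.mem_preimage, mem_closedBall_zero_iff]
    exact ((InnerProductSpace.toDual ℝ H).norm_map (u n)).trans_le hn
  obtain ⟨f, -, hf⟩ := (WeakDual.isCompact_closedBall (𝕜 := ℝ) (E := H) 0 M).ultrafilter_le_nhds
    (U.map φ) (by rw [le_principal_iff]; exact hmem)
  refine ⟨(InnerProductSpace.toDual ℝ H).symm (WeakDual.toStrongDual f), fun h => ?_⟩
  have h1 : Tendsto (fun n => φ n h) U (𝓝 (f h)) :=
    ((WeakDual.eval_continuous h).tendsto f).comp hf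
  rw [real_inner_comm, InnerProductSpace.toDual_symm_apply]
  refine h1.congr fun n => ?_
  rw [real_inner_comm]
  rfl

/-- Otherwise some ultrafilter finer than `atTop` carries a bounded part of the sequence, and its
weak limit is a fixed point by demiclosedness. -/
theorem tendsto_norm_atTop_of_fixedPoints_eq_empty {T : H → H}
    (hT : ∀ x y, ‖T x - T y‖ ≤ ‖x - y‖) {u : ℕ → H}
    (hd : Tendsto (fun n => T (u n) - u n) atTop (𝓝 0))
    (hfix : Function.fixedPoints T = ∅) : Tendsto (fun n => ‖u n‖) atTop atTop := by
  by_contra hcon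
  rw [tendsto_atTop] at hcon
  push Not at hcon
  obtain ⟨M, hM⟩ := hcon
  have : (atTop ⊓ 𝓟 {n | ‖u n‖ < M}).NeBot := frequently_mem_iff_neBot.1 hM
  set U := Ultrafilter.of (atTop ⊓ 𝓟 {n | ‖u n‖ < M})
  have hU : (U : Filter ℕ) ≤ atTop ⊓ 𝓟 {n | ‖u n‖ < M} := Ultrafilter.of_le _
  have hb : ∀ᶠ n in (U : Filter ℕ), ‖u n‖ ≤ M := by
    have h : ∀ᶠ n in (U : Filter ℕ), ‖u n‖ < M := le_principal_iff.1 (hU.trans inf_le_right)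
    exact h.mono fun _ => le_of_lt
  obtain ⟨a, ha⟩ := exists_tendsto_inner_of_bounded U hb
  have : T a = a :=
    eq_of_tendsto_inner_of_tendsto_sub hT hb ha (hd.mono_left (hU.trans inf_le_left))
  exact Set.eq_empty_iff_forall_notMem.1 hfix a this

/-- Opial's theorem for asymptotically regular orbits of nonexpansive maps. -/
theorem exists_weaklyTendsto_fixedPoint {T : H → H} (hT : ∀ x y, ‖T x - T y‖ ≤ ‖x - y‖)
    {u : ℕ → H} (hu : ∀ n, u (n + 1) = T (u n))
    (hd : Tendsto (fun n => T (u n) - u n) atTop (𝓝 0))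
    (hfix : (Function.fixedPoints T).Nonempty) :
    ∃ a ∈ Function.fixedPoints T, WeaklyTendsto u a := by
  have hanti : ∀ z, T z = z → Antitone fun n => ‖u n - z‖ := fun z hz =>
    antitone_nat_of_succ_le fun n => by
      have := hT (u n) z
      rwa [hz, ← hu] at this
  obtain ⟨z, hz⟩ := hfix
  have hb : ∀ n, ‖u n‖ ≤ ‖u 0 - z‖ + ‖z‖ := fun n => by
    calc ‖u n‖ = ‖(u n - z) + z‖ := by rw [sub_add_cancel]
      _ ≤ _ := norm_add_le _ _
      _ ≤ _ := by gcongr; exact hanti z hz (Nat.zero_le n)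
  have hcluster : ∀ U : Ultrafilter ℕ, (U : Filter ℕ) ≤ atTop → ∃ a, T a = a ∧
      ∀ h, Tendsto (fun n => inner ℝ h (u n)) U (𝓝 (inner ℝ h a)) := fun U hU => by
    obtain ⟨a, ha⟩ := exists_tendsto_inner_of_bounded U (Eventually.of_forall hb)
    exact ⟨a, eq_of_tendsto_inner_of_tendsto_sub hT (Eventually.of_forall hb) ha
      (hd.mono_left hU), ha⟩
  have hlim : ∀ z, T z = z → ∃ l, Tendsto (fun n => ‖u n - z‖ ^ 2) atTop (𝓝 l) := fun z hz =>
    ⟨_, (tendsto_atTop_ciInf (hanti z hz) ⟨0, by rintro _ ⟨k, rfl⟩; positivity⟩).pow 2⟩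
  obtain ⟨a, haT, ha⟩ := hcluster (Ultrafilter.of atTop) (Ultrafilter.of_le _)
  refine ⟨a, haT, weaklyTendsto_iff.2 fun h => ?_⟩
  refine tendsto_iff_ultrafilter _ _ _ |>.2 fun V hV => ?_
  obtain ⟨b, hbT, hb⟩ := hcluster V hV
  suffices a = b by rw [this]; exact hb h
  obtain ⟨l, hl⟩ := hlim a haT
  obtain ⟨m, hm⟩ := hlim b hbT
  -- By polarization, ⟨a - b, u n⟩ is determined by the distances to a and b, so it converges along
  -- all of `atTop`. Its limits ⟨a - b, a⟩ and ⟨a - b, b⟩ along the two ultrafilters then agree.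
  have hab : Tendsto (fun n => inner ℝ (a - b) (u n)) atTop
      (𝓝 ((m - l + ‖a‖ ^ 2 - ‖b‖ ^ 2) / 2)) := by
    refine ((((hm.sub hl).add_const (‖a‖ ^ 2)).sub_const (‖b‖ ^ 2)).div_const 2).congr fun n => ?_
    rw [norm_sub_sq_real, norm_sub_sq_real, inner_sub_left, real_inner_comm (u n) a,
      real_inner_comm (u n) b]
    ring
  have e1 := tendsto_nhds_unique (ha (a - b)) (hab.mono_left (Ultrafilter.of_le _))
  have e2 := tendsto_nhds_unique (hb (a - b)) (hab.mono_left hV)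
  have e3 : inner ℝ (a - b) (a - b) = 0 := by rw [inner_sub_right, e1, e2, sub_self]
  exact sub_eq_zero.1 (inner_self_eq_zero.1 e3)

end Weak

/-! ### Index arithmetic modulo N -/

section Cyclic

variable {N : ℕ} [NeZero N]

theorem ofNat_add_one (k : ℕ) : Fin.ofNat N k + 1 = Fin.ofNat N (k + 1) := by
  ext; simp [Fin.val_add]

theorem ofNat_add_period (k : ℕ) : Fin.ofNat N (k + N) = Fin.ofNat N k := by
  ext; simp

theorem ofNat_val (i : Fin N) : Fin.ofNat N i.val = i := by
  ext; simp

theorem add_ofNat (i : Fin N) (k : ℕ) : i + Fin.ofNat N k = Fin.ofNat N (i.val + k) := by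
  ext; simp [Fin.val_add]

theorem ofNat_mul_add (n k : ℕ) : Fin.ofNat N (n * N + k) = Fin.ofNat N k := by
  ext; simp

theorem steps_shift {E : Type*} (S : Fin N → E → E) (z : E) (i : Fin N) (k : ℕ) :
    steps (fun j => S (i + j)) (steps S z i.val) k = steps S z (i.val + k) := by
  induction k with
  | zero => rfl
  | succ k ih => rw [steps, ih, add_ofNat, ← add_assoc, steps]

theorem steps_mul_add {E : Type*} (S : Fin N → E → E) (z : E) (n k : ℕ) :
    steps S (steps S z (n * N)) k = steps S z (n * N + k) := by
  induction k with
  | zero => rfl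
  | succ k ih => rw [steps, ih, ← add_assoc, steps, ofNat_mul_add]

theorem steps_add_period {E : Type*} {S : Fin N → E → E} {z : E} (hz : steps S z N = z) (k : ℕ) :
    steps S z (k + N) = steps S z k := by
  have := steps_mul_add S z 1 k
  rw [one_mul, hz] at this
  rw [this, add_comm]

end Cyclic

/-! ### Cyclic operators as periodic orbits, and their shadows -/

section Steps

variable {N : ℕ} [NeZero N]

theorem drStart_eq (C : Fin N → Set H) (x₀ : H) (n : ℕ) :
    drStart C x₀ n = steps (fun k => drOp (C k) (C (k + 1))) x₀ (n * N) := by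
  induction n with
  | zero => rw [zero_mul]; rfl
  | succ n ih => rw [drStart, ih, steps_mul_add, add_mul, one_mul]

theorem drSeq_eq (C : Fin N → Set H) (x₀ : H) (n i : ℕ) :
    drSeq C x₀ n i = steps (fun k => drOp (C k) (C (k + 1))) x₀ (n * N + i) := by
  rw [drSeq, drStart_eq, steps_mul_add]

theorem tendsto_mul_add_atTop (i : ℕ) : Tendsto (fun n => n * N + i) atTop atTop :=
  tendsto_atTop_mono (fun n => (Nat.le_mul_of_pos_right n (NeZero.pos N)).trans
    (Nat.le_add_right _ _)) tendsto_id

theorem cyclicDRFrom_eq (C : Fin N → Set H) (i : Fin N) (z : H) :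
    cyclicDRFrom C i z = steps (fun k => drOp (C (i + k)) (C (i + k + 1))) z N := by
  simp only [cyclicDRFrom, cyclicDR, add_assoc]

theorem cyclicDRFrom_steps (C : Fin N → Set H) (x₀ : H) (n : ℕ) (i : Fin N) :
    cyclicDRFrom C i (steps (fun k => drOp (C k) (C (k + 1))) x₀ (n * N + i.val))
      = steps (fun k => drOp (C k) (C (k + 1))) x₀ (n * N + i.val + N) := by
  rw [cyclicDRFrom_eq, ← steps_mul_add, add_assoc, ← steps_mul_add]
  exact steps_shift (fun k => drOp (C k) (C (k + 1))) _ i N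

theorem isDROrbit_steps (C : Fin N → Set H) (x₀ : H) :
    IsDROrbit (fun k => C (Fin.ofNat N k)) (steps (fun k => drOp (C k) (C (k + 1))) x₀) :=
  fun k => by rw [steps, ofNat_add_one]

/-- T_{i,i+1} intertwines T_{[σ_i]} with T_{[σ_{i+1}]}, so it carries fixed points to fixed points.
Hence existence of fixed points does not depend on i. -/
theorem cyclicDRFrom_drOp (C : Fin N → Set H) {i : Fin N} {z : H}
    (hz : cyclicDRFrom C i z = z) :
    cyclicDRFrom C (i + 1) (drOp (C i) (C (i + 1)) z) = drOp (C i) (C (i + 1)) z := by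
  set S : Fin N → H → H := fun k => drOp (C (i + k)) (C (i + k + 1)) with hS
  have hzN : steps S z N = z := by rw [← cyclicDRFrom_eq, hz]
  have h1 : steps S z 1 = drOp (C i) (C (i + 1)) z := by
    simp only [steps, hS]
    rw [show i + Fin.ofNat N 0 = i by rw [add_ofNat, add_zero, ofNat_val]]
  have key : ∀ k, steps (fun k => drOp (C (i + 1 + k)) (C (i + 1 + k + 1))) (steps S z 1) k
      = steps S z (k + 1) := by
    intro k
    induction k with
    | zero => rfl
    | succ k ih =>
      rw [steps, ih, show i + 1 + Fin.ofNat N k = i + Fin.ofNat N (k + 1) by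
        rw [← ofNat_add_one, add_assoc, add_comm 1]]
      rfl
  rw [← h1, cyclicDRFrom_eq, key, add_comm, steps_add_period hzN]

theorem fixedPoints_cyclicDRFrom_nonempty (C : Fin N → Set H) {i : Fin N}
    (hi : (Function.fixedPoints (cyclicDRFrom C i)).Nonempty) (j : Fin N) :
    (Function.fixedPoints (cyclicDRFrom C j)).Nonempty := by
  have h : ∀ k : ℕ, (Function.fixedPoints (cyclicDRFrom C (i + Fin.ofNat N k))).Nonempty := by
    intro k
    induction k with
    | zero => rwa [add_ofNat, add_zero, ofNat_val]
    | succ k ih =>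
      obtain ⟨z, hz⟩ := ih
      rw [← ofNat_add_one, ← add_assoc]
      exact ⟨_, cyclicDRFrom_drOp C hz⟩
  have := h (j - i).val
  rwa [ofNat_val, add_sub_cancel] at this

theorem drOp_sub_self_eq_of_proj_reflect_eq {A B : Set H} {x : H}
    (h : proj B (reflect A x) = proj B (drOp A B x)) :
    drOp A B x - x = proj B (drOp A B x) - proj A x := by
  rw [drOp_sub_self, h]

variable [CompleteSpace H]

theorem norm_cyclicDRFrom_sub_le {C : Fin N → Set H} (hC : ∀ i, IsClosedConvex (C i)) (i : Fin N)
    (z w : H) : ‖cyclicDRFrom C i z - cyclicDRFrom C i w‖ ≤ ‖z - w‖ :=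
  (isDROrbit_steps (fun k => C (i + k)) z).antitone_norm_sub (fun _ => hC _)
    (isDROrbit_steps (fun k => C (i + k)) w) (Nat.zero_le N)

theorem steps_proj_mem {C : Fin N → Set H} (hC : ∀ i, IsClosedConvex (C i)) {q : H} (hq : q ∈ C 0)
    (k : ℕ) : steps (fun k => proj (C (k + 1))) q k ∈ C (Fin.ofNat N k) := by
  cases k with
  | zero => exact hq
  | succ k => rw [← ofNat_add_one]; exact proj_mem (hC _) _

theorem steps_drOp_eq_steps_proj {C : Fin N → Set H} (hC : ∀ i, IsClosedConvex (C i)) {q : H}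
    (hq : q ∈ C 0) (k : ℕ) : steps (fun k => drOp (C k) (C (k + 1))) q k
      = steps (fun k => proj (C (k + 1))) q k := by
  induction k with
  | zero => rfl
  | succ k ih => rw [steps, ih, drOp_of_mem (hC _) _ (steps_proj_mem hC hq k), steps]

theorem mem_of_cyclicProj_eq {C : Fin N → Set H} (hC : ∀ i, IsClosedConvex (C i)) {q : H}
    (hq : cyclicProj C q = q) : q ∈ C 0 := by
  obtain ⟨n, hn⟩ := Nat.exists_eq_succ_of_ne_zero (NeZero.ne N)
  have h : steps (fun k => proj (C (k + 1))) q (n + 1) ∈ C (Fin.ofNat N n + 1) :=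
    proj_mem (hC _) _
  rw [ofNat_add_one, ← Nat.succ_eq_add_one, ← hn] at h
  have e : Fin.ofNat N N = 0 := by ext; simp
  rw [e] at h
  rwa [← hq]

/-- The increments of two periodic orbits coincide. -/
theorem IsDROrbit.step_eq_of_periodic {A : ℕ → Set H} {x y : ℕ → H}
    (hA : ∀ k, IsClosedConvex (A k)) (hx : IsDROrbit A x) (hy : IsDROrbit A y)
    (hxN : ∀ k, x (k + N) = x k) (hyN : ∀ k, y (k + N) = y k) (k : ℕ) :
    x (k + 1) - x k = y (k + 1) - y k := by
  have hxP : ∀ n k, x (n * N + k) = x k := fun n k => by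
    rw [add_comm]; exact Function.Periodic.nat_mul hxN n k
  have hyP : ∀ n k, y (n * N + k) = y k := fun n k => by
    rw [add_comm]; exact Function.Periodic.nat_mul hyN n k
  have h := (hx.tendsto_step_sub hA hy).comp (tendsto_mul_add_atTop (N := N) k)
  refine sub_eq_zero.1 (tendsto_nhds_unique (tendsto_const_nhds.congr fun n => ?_) h)
  simp only [Function.comp_apply, add_assoc, hxP, hyP]

/-- On a periodic orbit `w` the two projections agree. -/
theorem IsDROrbit.proj_reflect_eq_of_periodic {A : ℕ → Set H} {w : ℕ → H}
    (hA : ∀ k, IsClosedConvex (A k)) (hper : ∀ k, A (k + N) = A k) (hw : IsDROrbit A w)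
    (hwN : ∀ k, w (k + N) = w k) (k : ℕ) :
    proj (A (k + 1)) (reflect (A k) (w k)) = proj (A (k + 1)) (w (k + 1)) := by
  have hwP : ∀ n k, w (n * N + k) = w k := fun n k => by
    rw [add_comm]; exact Function.Periodic.nat_mul hwN n k
  have hAP : ∀ n k, A (n * N + k) = A k := fun n k => by
    rw [add_comm]; exact Function.Periodic.nat_mul hper n k
  have h := (hw.tendsto_proj_reflect_sub hA (NeZero.ne N) hper).comp
    (tendsto_mul_add_atTop (N := N) k)
  refine sub_eq_zero.1 (tendsto_nhds_unique (tendsto_const_nhds.congr fun n => ?_) h)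
  simp only [Function.comp_apply, add_assoc, hwP, hAP]

/-- With s the common projection, P_A x - s = (T x - s) + (R_A x - s) is a sum of two normal vectors
to B at s. Thus the shadows of a periodic orbit follow the cyclic projections. -/
theorem proj_proj_of_proj_reflect_eq {A B : Set H} (hB : IsClosedConvex B) {x : H}
    (h : proj B (reflect A x) = proj B (drOp A B x)) :
    proj B (proj A x) = proj B (drOp A B x) := by
  have h1 := drOp_sub_self_eq_of_proj_reflect_eq h
  refine proj_eq_of_inner_le hB (proj_mem hB _) fun c hc => ?_
  have e1 := inner_proj_le hB (drOp A B x) hc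
  have e2 := inner_proj_le hB (reflect A x) hc
  rw [h] at e2
  have e : proj A x - proj B (drOp A B x)
      = (drOp A B x - proj B (drOp A B x)) + (reflect A x - proj B (drOp A B x)) := by
    obtain h2 : drOp A B x = proj B (drOp A B x) - proj A x + x := eq_add_of_sub_eq h1
    generalize proj B (drOp A B x) = s at *
    rw [h2, reflect_def]
    module
  rw [e, inner_add_left]
  linarith

end Steps

end CyclicDR

/-! ### Assembly of the dichotomy -/

theorem theorem2p8 {H : Type*} [NormedAddCommGroup H] [InnerProductSpace ℝ H] [CompleteSpace H]
    {N : ℕ} [NeZero N] (C : Fin N → Set H)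
    (hne : ∀ i, (C i).Nonempty) (hcl : ∀ i, IsClosed (C i)) (hcv : ∀ i, Convex ℝ (C i))
    (x₀ : H) (x : ℕ → ℕ → H) (hx : x = CyclicDR.drSeq C x₀) :
    -- part (a)
    (∀ i : Fin N,
      (∀ n, CyclicDR.proj (C (i + 1)) (CyclicDR.reflect (C i) (x n i.val))
          - CyclicDR.proj (C (i + 1)) (x n (i.val + 1))
        = (x n (i.val + 1) - x n i.val)
          - (CyclicDR.proj (C (i + 1)) (x n (i.val + 1)) - CyclicDR.proj (C i) (x n i.val))) ∧
      Tendsto (fun n => CyclicDR.proj (C (i + 1)) (CyclicDR.reflect (C i) (x n i.val))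
          - CyclicDR.proj (C (i + 1)) (x n (i.val + 1))) atTop (𝓝 0)) ∧
    -- part (b): exactly one of the two alternatives holds
    Xor (∀ i : Fin N, Function.fixedPoints (CyclicDR.cyclicDRFrom C i) = ∅)
      (∀ i : Fin N, (Function.fixedPoints (CyclicDR.cyclicDRFrom C i)).Nonempty) ∧
    -- alternative (i)
    ((∀ i : Fin N, Function.fixedPoints (CyclicDR.cyclicDRFrom C i) = ∅) →
      ∀ i : Fin N, Tendsto (fun n => ‖x n i.val‖) atTop atTop) ∧
    -- alternative (ii)
    ((∀ i : Fin N, (Function.fixedPoints (CyclicDR.cyclicDRFrom C i)).Nonempty) →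
      ∃ d : Fin N → H,
        -- the difference vectors exist and are well defined
        CyclicDR.IsDifferenceVectors C d ∧
        (∀ d' : Fin N → H, CyclicDR.IsDifferenceVectors C d' → d' = d) ∧
        ∃ z : Fin N → H, ∀ i : Fin N,
          CyclicDR.WeaklyTendsto (fun n => x n i.val) (z i) ∧
          z i ∈ Function.fixedPoints (CyclicDR.cyclicDRFrom C i) ∧
          z (i + 1) = CyclicDR.drOp (C i) (C (i + 1)) (z i) ∧
          (∀ n, x n (i.val + 1) - x n i.val
            = CyclicDR.proj (C (i + 1)) (CyclicDR.reflect (C i) (x n i.val))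
              - CyclicDR.proj (C i) (x n i.val)) ∧
          Tendsto (fun n => x n (i.val + 1) - x n i.val) atTop (𝓝 (d i)) ∧
          Tendsto (fun n => CyclicDR.proj (C (i + 1)) (x n (i.val + 1))
            - CyclicDR.proj (C i) (x n i.val)) atTop (𝓝 (d i)) ∧
          z (i + 1) - z i
            = CyclicDR.proj (C (i + 1)) (z (i + 1)) - CyclicDR.proj (C i) (z i) ∧
          CyclicDR.proj (C (i + 1)) (z (i + 1)) - CyclicDR.proj (C i) (z i) = d i ∧
          CyclicDR.proj (C (i + 1)) (CyclicDR.reflect (C i) (z i))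
            = CyclicDR.proj (C (i + 1)) (z (i + 1))) := by 
  have hC : ∀ i, CyclicDR.IsClosedConvex (C i) := fun i => ⟨hne i, hcl i, hcv i⟩
  set S : Fin N → H → H := fun k => CyclicDR.drOp (C k) (C (k + 1)) with hS
  set A : ℕ → Set H := fun k => C (Fin.ofNat N k) with hA_def
  have hA : ∀ k, CyclicDR.IsClosedConvex (A k) := fun k => hC _
  have hper : ∀ k, A (k + N) = A k := fun k => by
    simp only [hA_def, CyclicDR.ofNat_add_period]
  have hAi : ∀ i : Fin N, A i.val = C i := fun i => by
    simp only [hA_def, CyclicDR.ofNat_val]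
  have hAi1 : ∀ i : Fin N, A (i.val + 1) = C (i + 1) := fun i => by
    simp only [hA_def, ← CyclicDR.ofNat_add_one, CyclicDR.ofNat_val]
  have hAP : ∀ n k, A (n * N + k) = A k := fun n k => by
    simp only [hA_def, CyclicDR.ofNat_mul_add]
  set X : ℕ → H := CyclicDR.steps S x₀ with hX_def
  have hX : CyclicDR.IsDROrbit A X := CyclicDR.isDROrbit_steps C x₀
  have hxX : ∀ n i, x n i = X (n * N + i) := fun n i => by rw [hx, CyclicDR.drSeq_eq]
  have hstep : ∀ (i : Fin N) n,
      x n (i.val + 1) = CyclicDR.drOp (C i) (C (i + 1)) (x n i.val) := fun i n => by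
    rw [hxX, hxX, ← add_assoc, hX, add_assoc, hAP, hAP, hAi, hAi1]
  have hT : ∀ (i : Fin N) n,
      CyclicDR.cyclicDRFrom C i (x n i.val) = X (n * N + i.val + N) := fun i n => by
    rw [hxX]; exact CyclicDR.cyclicDRFrom_steps C x₀ n i
  have hreg : ∀ i : Fin N, Tendsto
      (fun n => CyclicDR.cyclicDRFrom C i (x n i.val) - x n i.val) atTop (𝓝 0) := fun i => by
    refine ((hX.tendsto_add_period_sub hA (NeZero.ne N) hper).comp
      (CyclicDR.tendsto_mul_add_atTop (N := N) i.val)).congr fun n => ?_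
    rw [hT, hxX]; rfl
  have hshadow : ∀ i : Fin N, Tendsto
      (fun n => CyclicDR.proj (C (i + 1)) (CyclicDR.reflect (C i) (x n i.val))
        - CyclicDR.proj (C (i + 1)) (x n (i.val + 1))) atTop (𝓝 0) := fun i => by
    refine ((hX.tendsto_proj_reflect_sub hA (NeZero.ne N) hper).comp
      (CyclicDR.tendsto_mul_add_atTop (N := N) i.val)).congr fun n => ?_
    simp only [Function.comp_apply, add_assoc, hAP, hAi, hAi1, hxX]
  have hid : ∀ (i : Fin N) n,
      CyclicDR.proj (C (i + 1)) (CyclicDR.reflect (C i) (x n i.val))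
        - CyclicDR.proj (C (i + 1)) (x n (i.val + 1))
      = (x n (i.val + 1) - x n i.val)
        - (CyclicDR.proj (C (i + 1)) (x n (i.val + 1)) - CyclicDR.proj (C i) (x n i.val)) :=
    fun i n => by rw [hstep]; exact CyclicDR.proj_reflect_sub_proj_drOp _ _ _
  refine ⟨fun i => ⟨hid i, hshadow i⟩, ?_, fun hempty i => ?_, fun hfix => ?_⟩
  · by_cases h : (Function.fixedPoints (CyclicDR.cyclicDRFrom C 0)).Nonempty
    · exact Or.inr ⟨CyclicDR.fixedPoints_cyclicDRFrom_nonempty C h, fun h' => h.ne_empty (h' 0)⟩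
    · refine Or.inl ⟨fun i => Set.not_nonempty_iff_eq_empty.1 fun hi => h ?_, fun h' => h (h' 0)⟩
      exact CyclicDR.fixedPoints_cyclicDRFrom_nonempty C hi 0
  · exact CyclicDR.tendsto_norm_atTop_of_fixedPoints_eq_empty
      (CyclicDR.norm_cyclicDRFrom_sub_le hC i) (hreg i) (hempty i)
  · obtain ⟨w₀, hw₀, hweak⟩ := CyclicDR.exists_weaklyTendsto_fixedPoint
      (CyclicDR.norm_cyclicDRFrom_sub_le hC 0) (u := fun n => x n (0 : Fin N).val)
      (fun n => by
        rw [hT, hxX]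
        congr 1
        ring) (hreg 0) (hfix 0)
    -- The orbit of the weak limit is periodic; its first N points are the x^i.
    set W : ℕ → H := CyclicDR.steps S w₀ with hW_def
    have hW : CyclicDR.IsDROrbit A W := CyclicDR.isDROrbit_steps C w₀
    have hWN : ∀ k, W (k + N) = W k := by
      refine CyclicDR.steps_add_period ?_
      have := CyclicDR.cyclicDRFrom_steps C w₀ 0 0
      simp only [zero_mul, zero_add, Fin.val_zero] at this
      exact this.symm.trans hw₀
    have hWP : ∀ n k, W (n * N + k) = W k := fun n k => by
      rw [add_comm]; exact Function.Periodic.nat_mul hWN n k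
    have hWstep : ∀ i : Fin N,
        W (i.val + 1) = CyclicDR.drOp (C i) (C (i + 1)) (W i.val) := fun i => by
      rw [hW, hAi, hAi1]
    -- Periodicity handles the wraparound at i = N - 1, where (i + 1).val is 0.
    have hWsucc : ∀ i : Fin N, W (i + 1).val = W (i.val + 1) := fun i => by
      rw [← CyclicDR.ofNat_val i, CyclicDR.ofNat_add_one, CyclicDR.ofNat_val]
      exact Function.Periodic.map_mod_nat hWN _
    have hPR : ∀ i : Fin N, CyclicDR.proj (C (i + 1)) (CyclicDR.reflect (C i) (W i.val))
        = CyclicDR.proj (C (i + 1)) (W (i.val + 1)) := fun i => by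
      have := hW.proj_reflect_eq_of_periodic hA hper hWN i.val
      rwa [hAi, hAi1] at this
    have hdiff : ∀ i : Fin N, W (i.val + 1) - W i.val
        = CyclicDR.proj (C (i + 1)) (W (i.val + 1)) - CyclicDR.proj (C i) (W i.val) := fun i => by
      have := hPR i
      rw [hWstep] at this ⊢
      exact CyclicDR.drOp_sub_self_eq_of_proj_reflect_eq this
    have hQ : ∀ k, CyclicDR.steps (fun k => CyclicDR.proj (C (k + 1))) (CyclicDR.proj (C 0) w₀) k
        = CyclicDR.proj (A k) (W k) := by
      intro k
      induction k with
      | zero => rfl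
      | succ k ih =>
        have := hW.proj_reflect_eq_of_periodic hA hper hWN k
        rw [hW] at this
        rw [CyclicDR.steps, ih, hW, ← CyclicDR.proj_proj_of_proj_reflect_eq (hA _) this,
          CyclicDR.ofNat_add_one]
    have hXW : ∀ i : Fin N, Tendsto (fun n => x n (i.val + 1) - x n i.val) atTop
        (𝓝 (W (i.val + 1) - W i.val)) := fun i => by
      have h := ((hX.tendsto_step_sub hA hW).comp
        (CyclicDR.tendsto_mul_add_atTop (N := N) i.val)).add_const (W (i.val + 1) - W i.val)
      rw [zero_add] at h
      refine h.congr fun n => ?_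
      simp only [Function.comp_apply, add_assoc, hWP, hxX, sub_add_cancel]
    -- Weak continuity of the operators is not used: the increments converge in norm, so adding them
    -- carries the weak limit from k to k + 1.
    have hweakW : ∀ k, CyclicDR.WeaklyTendsto (fun n => x n k) (W k) := by
      intro k
      induction k with
      | zero => exact hweak
      | succ k ih =>
        have h := ((hX.tendsto_step_sub hA hW).comp
          (CyclicDR.tendsto_mul_add_atTop (N := N) k)).add_const (W (k + 1) - W k)
        rw [zero_add] at h
        rw [CyclicDR.weaklyTendsto_iff] at ih ⊢
        intro v
        have h2 := (ih v).add ((tendsto_const_nhds (x := v)).inner (𝕜 := ℝ) h)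
        rw [← inner_add_right, add_sub_cancel] at h2
        refine h2.congr fun n => ?_
        rw [← inner_add_right]
        simp only [Function.comp_apply, add_assoc, hWP, hxX, sub_add_cancel, add_sub_cancel]
    refine ⟨fun i => W (i.val + 1) - W i.val, ⟨CyclicDR.proj (C 0) w₀, ?_, fun i => ?_⟩, ?_,
      fun i => W i.val, fun i => ⟨hweakW _, ?_, ?_, fun n => ?_, hXW i, ?_, ?_, ?_, ?_⟩⟩
    · refine (hQ N).trans ?_
      have h1 := hper 0
      have h2 := hWN 0
      rw [zero_add] at h1 h2
      rw [h1, h2]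
      rfl
    · rw [hQ, hQ, hAi, hAi1]; exact hdiff i
    -- The projection cycle of any q is itself a periodic Douglas–Rachford orbit, so it has the
    -- increments of `W`.
    · rintro d' ⟨q, hq, hd'⟩
      have hq0 : q ∈ C 0 := CyclicDR.mem_of_cyclicProj_eq hC hq
      have hqN : CyclicDR.steps S q N = q :=
        (CyclicDR.steps_drOp_eq_steps_proj hC hq0 N).trans hq
      funext i
      rw [hd', ← CyclicDR.steps_drOp_eq_steps_proj hC hq0,
        ← CyclicDR.steps_drOp_eq_steps_proj hC hq0]
      exact (CyclicDR.isDROrbit_steps C q).step_eq_of_periodic hA hW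
        (CyclicDR.steps_add_period hqN) hWN i.val
    · have := CyclicDR.cyclicDRFrom_steps C w₀ 0 i
      rw [zero_mul, zero_add] at this
      exact this.trans (hWN i.val)
    · exact (hWsucc i).trans (hWstep i)
    · rw [hstep, CyclicDR.drOp_sub_self]
    · have := (hXW i).sub (hshadow i)
      rw [sub_zero] at this
      refine this.congr fun n => ?_
      rw [hid, sub_sub_cancel]
    · simp only [hWsucc]; exact hdiff i
    · simp only [hWsucc]; exact (hdiff i).symm
    · simp only [hWsucc]; exact hPR i
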